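/- Let $\Gamma$ be a set of sites with a metric $\rho$ such that $\rho(x,y)\ge 1$ for $x\neq y$ and such that for every $M>0$ there is a number $N_M$ with $|\{y : \rho(x,y)\le M\}|\le N_M$ for all $x\in\Gamma$. Fix an integer $d\ge 1$. For finite $\Lambda\subset\Gamma$ let $\mathfrak A(\Lambda)=\bigotimes_{x\in\Lambda}M_d(\mathbb C)$, with the inclusions $A\mapsto A\otimes I$ for $\Lambda\subset\Lambda'$; let $\mathfrak A_{loc}=\bigcup_\Lambda\mathfrak A(\Lambda)$ be the $*$-algebra of strictly local observables and $\mathfrak A$ its norm completion, the quasi-local $C^*$-algebra. An interaction is a map $\Phi$ that assigns to every finite $X\subset\Gamma$ a self-adjoint $\Phi(X)\in\mathfrak A(X)$. Suppose that $\Phi$ is bounded, i.e. $\sup_{x\in\Gamma}\sum_{X\ni x}\|\Phi(X)\|<\infty$, and of finite range, i.e. there is $c>0$ with $\Phi(X)=0$ whenever $\operatorname{diam}(X)>c$. For finite $\Lambda\subset\Gamma$ put $H_\Lambda=\sum_{X\subset\Lambda}\Phi(X)$, $\delta_\Lambda(A)=i[H_\Lambda,A]$ and $\alpha^\Lambda_t=\exp(t\delta_\Lambda)$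 for $t\in\mathbb R$. Limits $\Lambda\to\infty$ are limits along the net of finite subsets of $\Gamma$ ordered by inclusion. For every $A\in\mathfrak A_{loc}$ the limit $\delta(A)=\lim_{\Lambda\to\infty}\delta_\Lambda(A)$ exists and lies in $\mathfrak A_{loc}$, and $\delta$ is a symmetric derivation: it is linear, $\delta(A^*)=\delta(A)^*$ and $\delta(AB)=\delta(A)B+A\delta(B)$. Moreover there is a strongly continuous one-parameter group $t\mapsto\alpha_t$, $t\in\mathbb R$, of $*$-automorphisms of $\mathfrak A$ such that: 1. $\alpha_t$ extends $\exp(t\delta)$: there is $t_0>0$ such that for all $A\in\mathfrak A_{loc}$ and all real $t$ with $|t|<t_0$ the series $\sum_{n\ge0}\frac{t^n}{n!}\delta^n(A)$ converges in norm to $\alpha_t(A)$; 2. for all $A\in\mathfrak A$ and all $t\in\mathbb R$, $\lim_{\Lambda\to\infty}\|\alpha^\Lambda_t(A)-\alpha_t(A)\|=0$, where $\alpha^\Lambda_t(A)=e^{itH_\Lambda}Ae^{-itH_\Lambda}$. -/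

import Mathlib

open Filter Topology
open scoped ENNReal Matrix.Norms.L2Operator

noncomputable section

namespace SpinSystem

/-! ### Local algebras

`Γ` is the set of sites and each site carries a `d`-level system. The algebra of a finite set
`Λ` of sites is `⨂_{x ∈ Λ} M_d(ℂ)`, realised as the matrices indexed by the configurations
`Λ → Fin d`, with the conjugate transpose as `*` and the operator norm. -/

/-- The algebra `𝔄(Λ) = ⨂_{x ∈ Λ} M_d(ℂ)` of observables of the finite set `Λ` of sites. -/
abbrev Obs (d : ℕ) {Γ : Type*} (Λ : Finset Γ) : Type _ :=
  Matrix (Λ → Fin d) (Λ → Fin d) ℂ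

/-- The elementary tensor `⨂_{x ∈ Λ} a x`. -/
def tensorObs (d : ℕ) {Γ : Type*} (Λ : Finset Γ) (a : Γ → Matrix (Fin d) (Fin d) ℂ) : Obs d Λ :=
  fun σ τ => ∏ x : Λ, a x (σ x) (τ x)

section Embedding

variable (d : ℕ) {Γ : Type*}

/-- Restriction of a configuration on `Λ'` to `Λ ⊆ Λ'`. -/
def restrictConfig {Λ Λ' : Finset Γ} (h : Λ ≤ Λ') (σ : Λ' → Fin d) : Λ → Fin d :=
  fun x => σ ⟨x.1, h x.2⟩

open Classical in
/-- The matrix of `A ⊗ I`, where `A` acts on the sites in `Λ` and `I` on those in `Λ' \ Λ`. -/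
def embedFun {Λ Λ' : Finset Γ} (h : Λ ≤ Λ') (A : Obs d Λ) : Obs d Λ' :=
  fun σ τ => if ∀ x : Λ', x.1 ∉ Λ → σ x = τ x then
    A (restrictConfig d h σ) (restrictConfig d h τ) else 0

variable {d} in
theorem config_ext {Λ Λ' : Finset Γ} (h : Λ ≤ Λ') {σ τ : Λ' → Fin d}
    (h₁ : ∀ x : Λ', x.1 ∉ Λ → σ x = τ x) (h₂ : restrictConfig d h σ = restrictConfig d h τ) :
    σ = τ := by
  funext x
  by_cases hx : x.1 ∈ Λ
  · exact congrFun h₂ ⟨x.1, hx⟩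
  · exact h₁ x hx

open Classical in
/-- The configuration equal to `ρ` on `Λ` and to `σ` on `Λ' \ Λ`. -/
def glueConfig {Λ Λ' : Finset Γ} (σ : Λ' → Fin d) (ρ : Λ → Fin d) : Λ' → Fin d :=
  fun x => if hx : x.1 ∈ Λ then ρ ⟨x.1, hx⟩ else σ x

variable {d} in
theorem restrict_glue {Λ Λ' : Finset Γ} (h : Λ ≤ Λ') (σ : Λ' → Fin d) (ρ : Λ → Fin d) :
    restrictConfig d h (glueConfig d σ ρ) = ρ := by
  funext x
  simp [restrictConfig, glueConfig]

variable {d} in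
theorem glue_off {Λ Λ' : Finset Γ} (σ : Λ' → Fin d) (ρ : Λ → Fin d) (x : Λ') (hx : x.1 ∉ Λ) :
    glueConfig d σ ρ x = σ x := by
  simp [glueConfig, hx]

/-- On elementary tensors the embedding inserts identity operators at the sites in `Λ' \ Λ`. -/
theorem embedFun_tensorObs {Λ Λ' : Finset Γ} (h : Λ ≤ Λ') (a : Γ → Matrix (Fin d) (Fin d) ℂ)
    (ha : ∀ x, x ∉ Λ → a x = 1) :
    embedFun d h (tensorObs d Λ a) = tensorObs d Λ' a := by
  classical
  ext σ τ
  have key : (∏ x : Λ', a x (σ x) (τ x)) =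
      (∏ x : Λ, a x (restrictConfig d h σ x) (restrictConfig d h τ x)) *
        ∏ x : {x : Λ' // x.1 ∉ Λ}, a x.1 (σ x.1) (τ x.1) := by
    rw [← Fintype.prod_subtype_mul_prod_subtype (fun x : Λ' => x.1 ∈ Λ)]
    congr 1
    exact Fintype.prod_equiv
      ⟨fun x => ⟨x.1.1, x.2⟩, fun x => ⟨⟨x.1, h x.2⟩, x.2⟩, fun _ => rfl, fun _ => rfl⟩ _ _
      (fun _ => rfl)
  unfold embedFun tensorObs
  rw [key]
  split_ifs with hc
  · rw [Finset.prod_eq_one (s := (Finset.univ : Finset {x : Λ' // x.1 ∉ Λ})), mul_one]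
    intro x _
    rw [ha _ x.2, hc x.1 x.2, Matrix.one_apply_eq]
  · push Not at hc
    obtain ⟨x, hx, hne⟩ := hc
    rw [Finset.prod_eq_zero (i := (⟨x, hx⟩ : {x : Λ' // x.1 ∉ Λ})) (Finset.mem_univ _), mul_zero]
    rw [ha _ hx, Matrix.one_apply_ne hne]

variable [DecidableEq Γ]

theorem embedFun_one {Λ Λ' : Finset Γ} (h : Λ ≤ Λ') : embedFun d h (1 : Obs d Λ) = 1 := by
  ext σ τ
  by_cases hst : σ = τ
  · subst hst; simp [embedFun]
  · rw [Matrix.one_apply_ne hst]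
    unfold embedFun
    split_ifs with hc
    · exact Matrix.one_apply_ne fun h₂ => hst (config_ext h hc h₂)
    · rfl

theorem embedFun_mul {Λ Λ' : Finset Γ} (h : Λ ≤ Λ') (A B : Obs d Λ) :
    embedFun d h (A * B) = embedFun d h A * embedFun d h B := by
  classical
  ext σ τ
  rw [Matrix.mul_apply]
  by_cases hc : ∀ x : Λ', x.1 ∉ Λ → σ x = τ x
  · have h₁ : embedFun d h (A * B) σ τ =
        ∑ ρ : Λ → Fin d, A (restrictConfig d h σ) ρ * B ρ (restrictConfig d h τ) := by
      simp only [embedFun, if_pos hc, Matrix.mul_apply]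
    rw [h₁]
    refine Finset.sum_of_injOn (glueConfig d σ) ?_ (fun _ _ => Finset.mem_coe.2 (Finset.mem_univ _))
      ?_ ?_
    · intro ρ _ ρ' _ e
      rw [← restrict_glue h σ ρ, e, restrict_glue]
    · intro ρ _ hρ
      unfold embedFun
      by_cases hr : ∀ x : Λ', x.1 ∉ Λ → σ x = ρ x
      · refine absurd ⟨restrictConfig d h ρ, Finset.mem_coe.2 (Finset.mem_univ _), ?_⟩ hρ
        exact config_ext h (fun x hx => by rw [glue_off _ _ _ hx, hr x hx]) (restrict_glue h _ _)
      · rw [if_neg hr, zero_mul]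
    · intro ρ _
      unfold embedFun
      rw [if_pos fun x hx => (glue_off σ ρ x hx).symm,
        if_pos fun x hx => (glue_off σ ρ x hx).trans (hc x hx), restrict_glue]
  · have h₁ : embedFun d h (A * B) σ τ = 0 := by simp only [embedFun, if_neg hc]
    rw [h₁, Finset.sum_eq_zero]
    intro ρ _
    by_cases hr : ∀ x : Λ', x.1 ∉ Λ → σ x = ρ x
    · have hr₂ : ¬ ∀ x : Λ', x.1 ∉ Λ → ρ x = τ x :=
        fun hr' => hc fun x hx => (hr x hx).trans (hr' x hx)
      simp only [embedFun, if_neg hr₂, mul_zero]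
    · simp only [embedFun, if_neg hr, zero_mul]

/-- The inclusion `𝔄(Λ) → 𝔄(Λ')`, `A ↦ A ⊗ I`, for `Λ ⊆ Λ'`. -/
def embed {Λ Λ' : Finset Γ} (h : Λ ≤ Λ') : Obs d Λ →⋆ₐ[ℂ] Obs d Λ' where
  toFun := embedFun d h
  map_one' := embedFun_one d h
  map_mul' := embedFun_mul d h
  map_zero' := by ext σ τ; simp [embedFun]
  map_add' A B := by
    ext σ τ
    simp only [embedFun, Matrix.add_apply]
    split_ifs <;> simp
  commutes' r := by
    rw [Algebra.algebraMap_eq_smul_one, Algebra.algebraMap_eq_smul_one]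
    conv_rhs => rw [← embedFun_one d h]
    ext σ τ
    simp only [embedFun, Matrix.smul_apply]
    split_ifs <;> simp
  map_star' A := by
    ext σ τ
    simp only [embedFun, Matrix.star_apply]
    by_cases hc : ∀ x : Λ', x.1 ∉ Λ → σ x = τ x
    · rw [if_pos hc, if_pos fun x hx => (hc x hx).symm]
    · rw [if_neg hc, if_neg fun hc' => hc fun x hx => (hc' x hx).symm, star_zero]

instance directedSystem :
    DirectedSystem (fun Λ : Finset Γ => Obs d Λ) (fun _ _ h => ⇑(embed d h)) where
  map_self Λ A := by
    ext σ τ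
    change embedFun d _ A σ τ = _
    unfold embedFun
    rw [if_pos fun x hx => absurd x.2 hx]
    rfl
  map_map Λ₁ Λ₂ Λ₃ h₁ h₂ A := by
    ext σ τ
    change embedFun d _ (embedFun d _ A) σ τ = embedFun d _ A σ τ
    unfold embedFun
    by_cases hc : ∀ x : Λ₁, x.1 ∉ Λ₃ → σ x = τ x
    · have hc₁ : ∀ x : Λ₁, x.1 ∉ Λ₂ → σ x = τ x := fun x hx => hc x fun hx' => hx (h₁ hx')
      have hc₂ : ∀ x : Λ₂, x.1 ∉ Λ₃ → restrictConfig d h₂ σ x = restrictConfig d h₂ τ x :=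
        fun x hx => hc ⟨x.1, h₂ x.2⟩ hx
      rw [if_pos hc, if_pos hc₁, if_pos hc₂]
      rfl
    · rw [if_neg hc]
      split_ifs with h₃ h₄
      · refine absurd (fun x hx => ?_) hc
        by_cases hx₂ : x.1 ∈ Λ₂
        · exact h₄ ⟨x.1, hx₂⟩ hx
        · exact h₃ x hx₂
      · rfl
      · rfl

theorem embed_injective [NeZero d] {Λ Λ' : Finset Γ} (h : Λ ≤ Λ') :
    Function.Injective (embed d h) := by
  intro A B hAB
  ext ρ ρ'
  have := congrFun (congrFun hAB (glueConfig d (fun _ => 0) ρ)) (glueConfig d (fun _ => 0) ρ')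
  change embedFun d h A _ _ = embedFun d h B _ _ at this
  unfold embedFun at this
  rwa [if_pos fun x hx => by rw [glue_off _ _ _ hx, glue_off _ _ _ hx],
    if_pos fun x hx => by rw [glue_off _ _ _ hx, glue_off _ _ _ hx],
    restrict_glue, restrict_glue] at this

theorem norm_embed [NeZero d] {Λ Λ' : Finset Γ} (h : Λ ≤ Λ') (A : Obs d Λ) :
    ‖embed d h A‖ = ‖A‖ :=
  NonUnitalStarAlgHom.norm_map (embed d h) (embed_injective d h) A

end Embedding

/-! ### The quasi-local algebra -/

/-- The `*`-algebra `𝔄_loc`: the inductive limit of the algebras `𝔄(Λ)`, `Λ ⊆ Γ` finite. -/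
def LocalLimit (d : ℕ) (Γ : Type*) [DecidableEq Γ] : Type _ :=
  DirectLimit (fun Λ : Finset Γ => Obs d Λ) (fun _ _ h => embed d h)

section LocalLimit

variable (d : ℕ) (Γ : Type*) [DecidableEq Γ]

instance : Ring (LocalLimit d Γ) :=
  inferInstanceAs (Ring (DirectLimit (fun Λ : Finset Γ => Obs d Λ) (fun _ _ h => embed d h)))

instance : Algebra ℂ (LocalLimit d Γ) :=
  inferInstanceAs
    (Algebra ℂ (DirectLimit (fun Λ : Finset Γ => Obs d Λ) (fun _ _ h => embed d h)))

instance : StarRing (LocalLimit d Γ) :=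
  inferInstanceAs (StarRing (DirectLimit (fun Λ : Finset Γ => Obs d Λ) (fun _ _ h => embed d h)))

instance : StarModule ℂ (LocalLimit d Γ) :=
  inferInstanceAs
    (StarModule ℂ (DirectLimit (fun Λ : Finset Γ => Obs d Λ) (fun _ _ h => embed d h)))

variable {Γ}

/-- The canonical map `𝔄(Λ) → 𝔄_loc`. -/
def toLimit (Λ : Finset Γ) : Obs d Λ →⋆ₐ[ℂ] LocalLimit d Γ where
  __ := DirectLimit.Algebra.of (R := ℂ) (fun Λ : Finset Γ => Obs d Λ) (fun _ _ h => embed d h) Λ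
  map_star' _ := rfl

variable {d}

theorem limit_induction {P : LocalLimit d Γ → Prop} (h : ∀ Λ A, P (toLimit d Λ A))
    (a : LocalLimit d Γ) : P a :=
  DirectLimit.induction (fun (_ _ : Finset Γ) h => embed d h) h a

theorem limit_induction₂ {P : LocalLimit d Γ → LocalLimit d Γ → Prop}
    (h : ∀ Λ A B, P (toLimit d Λ A) (toLimit d Λ B)) (a b : LocalLimit d Γ) : P a b :=
  DirectLimit.induction₂ (fun (_ _ : Finset Γ) h => embed d h) h a b

variable [NeZero d]

theorem toLimit_injective (Λ : Finset Γ) : Function.Injective (toLimit d Λ) :=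
  DirectLimit.mk_injective (fun (_ _ : Finset Γ) h => embed d h)
    (fun _ _ h => embed_injective d h) Λ

/-- The norm on `𝔄_loc` given by the norms of the algebras `𝔄(Λ)`. -/
def limitNorm : LocalLimit d Γ → ℝ :=
  DirectLimit.lift _ (fun (_ : Finset Γ) A => ‖A‖) fun _ _ h A => (norm_embed d h A).symm

theorem limitNorm_toLimit (Λ : Finset Γ) (A : Obs d Λ) : limitNorm (toLimit d Λ A) = ‖A‖ := rfl

variable (d Γ) in
/-- The norm of `𝔄_loc` as a group norm. -/
abbrev limitGroupNorm : AddGroupNorm (LocalLimit d Γ) where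
  toFun := limitNorm
  map_zero' := by rw [← map_zero (toLimit d (∅ : Finset Γ)), limitNorm_toLimit, norm_zero]
  add_le' := limit_induction₂ fun Λ A B => by
    rw [← map_add, limitNorm_toLimit, limitNorm_toLimit, limitNorm_toLimit]
    exact norm_add_le A B
  neg' := limit_induction fun Λ A => by
    rw [← map_neg, limitNorm_toLimit, limitNorm_toLimit, norm_neg]
  eq_zero_of_map_eq_zero' := limit_induction fun Λ A h => by
    rw [limitNorm_toLimit, norm_eq_zero] at h
    rw [h, map_zero]

instance : NormedRing (LocalLimit d Γ) where
  __ := (limitGroupNorm d Γ).toNormedAddCommGroup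
  __ := (inferInstance : Ring (LocalLimit d Γ))
  norm_mul_le := limit_induction₂ fun Λ A B => by
    change limitNorm (toLimit d Λ A * toLimit d Λ B) ≤
      limitNorm (toLimit d Λ A) * limitNorm (toLimit d Λ B)
    rw [← map_mul, limitNorm_toLimit, limitNorm_toLimit, limitNorm_toLimit]
    exact norm_mul_le A B

theorem norm_toLimit (Λ : Finset Γ) (A : Obs d Λ) : ‖toLimit d Λ A‖ = ‖A‖ := rfl

instance : NormedAlgebra ℂ (LocalLimit d Γ) where
  norm_smul_le r := limit_induction fun Λ A => by
    rw [← map_smul, norm_toLimit, norm_toLimit]; exact norm_smul_le r A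

instance : CStarRing (LocalLimit d Γ) where
  norm_mul_self_le := limit_induction fun Λ A => by
    rw [← map_star, ← map_mul, norm_toLimit, norm_toLimit]; exact CStarRing.norm_mul_self_le A

end LocalLimit

/-- The quasi-local algebra `𝔄`: the norm completion of `𝔄_loc`. -/
def QuasiLocal (d : ℕ) (Γ : Type*) [DecidableEq Γ] [NeZero d] : Type _ :=
  UniformSpace.Completion (LocalLimit d Γ)

section QuasiLocal

open UniformSpace

variable (d : ℕ) (Γ : Type*) [DecidableEq Γ] [NeZero d]

instance : NormedRing (QuasiLocal d Γ) :=
  inferInstanceAs (NormedRing (Completion (LocalLimit d Γ)))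

instance : Algebra ℂ (QuasiLocal d Γ) :=
  inferInstanceAs (Algebra ℂ (Completion (LocalLimit d Γ)))

instance : NormedAlgebra ℂ (QuasiLocal d Γ) where
  norm_smul_le := norm_smul_le (α := ℂ) (β := Completion (LocalLimit d Γ))

instance : CompleteSpace (QuasiLocal d Γ) :=
  inferInstanceAs (CompleteSpace (Completion (LocalLimit d Γ)))

/-- The extension of the `*`-operation of `𝔄_loc` by continuity. -/
instance : Star (QuasiLocal d Γ) where
  star := Completion.map (star : LocalLimit d Γ → LocalLimit d Γ)

variable {d Γ}

/-- The inclusion of `𝔄_loc` into its completion, as a function. -/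
def ofLimit (a : LocalLimit d Γ) : QuasiLocal d Γ := (a : Completion (LocalLimit d Γ))

theorem uniformContinuous_star_limit :
    UniformContinuous (star : LocalLimit d Γ → LocalLimit d Γ) :=
  (starₗᵢ ℂ : LocalLimit d Γ ≃ₗᵢ⋆[ℂ] LocalLimit d Γ).isometry.uniformContinuous

theorem continuous_star_quasiLocal :
    Continuous (star : QuasiLocal d Γ → QuasiLocal d Γ) :=
  Completion.continuous_map (f := (star : LocalLimit d Γ → LocalLimit d Γ))

theorem star_ofLimit (a : LocalLimit d Γ) : star (ofLimit a) = ofLimit (star a) :=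
  Completion.map_coe uniformContinuous_star_limit a

theorem quasiLocal_induction {P : QuasiLocal d Γ → Prop} (hP : IsClosed {A | P A})
    (h : ∀ a, P (ofLimit a)) (A : QuasiLocal d Γ) : P A :=
  Completion.induction_on A hP h

theorem quasiLocal_induction₂ {P : QuasiLocal d Γ → QuasiLocal d Γ → Prop}
    (hP : IsClosed {p : QuasiLocal d Γ × QuasiLocal d Γ | P p.1 p.2})
    (h : ∀ a b, P (ofLimit a) (ofLimit b)) (A B : QuasiLocal d Γ) : P A B :=
  Completion.induction_on₂ A B hP h

theorem ofLimit_mul (a b : LocalLimit d Γ) : ofLimit (a * b) = ofLimit a * ofLimit b :=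
  Completion.coe_mul a b

theorem ofLimit_add (a b : LocalLimit d Γ) : ofLimit (a + b) = ofLimit a + ofLimit b :=
  Completion.coe_add a b

theorem ofLimit_smul (r : ℂ) (a : LocalLimit d Γ) : ofLimit (r • a) = r • ofLimit a :=
  Completion.coe_smul r a

theorem norm_ofLimit (a : LocalLimit d Γ) : ‖ofLimit a‖ = ‖a‖ :=
  Completion.norm_coe a

instance : StarRing (QuasiLocal d Γ) where
  star_involutive := quasiLocal_induction
    (isClosed_eq (continuous_star_quasiLocal.comp continuous_star_quasiLocal) continuous_id)
    fun a => by rw [star_ofLimit, star_ofLimit, star_star]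
  star_mul := quasiLocal_induction₂
    (isClosed_eq (continuous_star_quasiLocal.comp (continuous_fst.mul continuous_snd))
      ((continuous_star_quasiLocal.comp continuous_snd).mul
        (continuous_star_quasiLocal.comp continuous_fst)))
    fun a b => by rw [← ofLimit_mul, star_ofLimit, star_mul, ofLimit_mul, star_ofLimit,
      star_ofLimit]
  star_add := quasiLocal_induction₂
    (isClosed_eq (continuous_star_quasiLocal.comp (continuous_fst.add continuous_snd))
      ((continuous_star_quasiLocal.comp continuous_fst).add
        (continuous_star_quasiLocal.comp continuous_snd)))
    fun a b => by rw [← ofLimit_add, star_ofLimit, star_add, ofLimit_add, star_ofLimit,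
      star_ofLimit]

/-- The quasi-local algebra is a unital C⋆-algebra. -/
instance : CStarAlgebra (QuasiLocal d Γ) where
  norm_mul_self_le := quasiLocal_induction
    (isClosed_le (continuous_norm.mul continuous_norm)
      (continuous_norm.comp (continuous_star_quasiLocal.mul continuous_id)))
    fun a => by
      rw [star_ofLimit, ← ofLimit_mul, norm_ofLimit, norm_ofLimit]
      exact CStarRing.norm_mul_self_le a
  star_smul r := quasiLocal_induction
    (isClosed_eq (continuous_star_quasiLocal.comp (continuous_const_smul r))
      (continuous_star_quasiLocal.const_smul (star r)))
    fun a => by rw [← ofLimit_smul, star_ofLimit, star_smul, ofLimit_smul, star_ofLimit]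

variable (d Γ)

/-- The inclusion `𝔄_loc → 𝔄` as a `*`-homomorphism. -/
def ofLimitHom : LocalLimit d Γ →⋆ₐ[ℂ] QuasiLocal d Γ where
  toFun := ofLimit
  map_one' := rfl
  map_mul' := ofLimit_mul
  map_zero' := rfl
  map_add' := ofLimit_add
  commutes' _ := rfl
  map_star' a := (star_ofLimit a).symm

variable {Γ}

/-- `𝔄(Λ)`, for finite `Λ`, as a `*`-subalgebra of the quasi-local algebra. -/
def localAlgebra (Λ : Finset Γ) : StarSubalgebra ℂ (QuasiLocal d Γ) :=
  ((ofLimitHom d Γ).comp (toLimit d Λ)).range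

variable (Γ)

/-- `𝔄_loc = ⋃_Λ 𝔄(Λ)`, the `*`-subalgebra of strictly local elements of `𝔄`. -/
def strictlyLocal : StarSubalgebra ℂ (QuasiLocal d Γ) :=
  (ofLimitHom d Γ).range

variable {d Γ}

theorem mem_strictlyLocal {A : QuasiLocal d Γ} :
    A ∈ strictlyLocal d Γ ↔ ∃ Λ : Finset Γ, A ∈ localAlgebra d Λ := by
  constructor
  · rintro ⟨a, rfl⟩
    exact limit_induction (P := fun a => ∃ Λ : Finset Γ, ofLimitHom d Γ a ∈ localAlgebra d Λ)
      (fun Λ A => ⟨Λ, A, rfl⟩) a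
  · rintro ⟨Λ, A, rfl⟩
    exact ⟨toLimit d Λ A, rfl⟩

end QuasiLocal

/-! ### Interactions and dynamics -/

/-- An interaction: a self-adjoint `Φ(X) ∈ 𝔄(X)` for each finite set `X` of sites. -/
structure Interaction (d : ℕ) (Γ : Type*) [DecidableEq Γ] [NeZero d] where
  /-- The interaction term of a finite set of sites. -/
  toFun : Finset Γ → QuasiLocal d Γ
  mem_localAlgebra : ∀ X, toFun X ∈ localAlgebra d X
  isSelfAdjoint : ∀ X, IsSelfAdjoint (toFun X)

namespace Interaction

variable {d : ℕ} {Γ : Type*} [DecidableEq Γ] [NeZero d] (Φ : Interaction d Γ)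

/-- `‖Φ‖ = sup_x ∑_{X ∋ x} ‖Φ(X)‖`, with values in `[0, ∞]`. -/
def size : ℝ≥0∞ := ⨆ x : Γ, ∑' X : {X : Finset Γ // x ∈ X}, ‖Φ.toFun X.1‖ₑ

/-- The interaction is bounded: `‖Φ‖ < ∞`. -/
def IsBounded : Prop := Φ.size < ∞

/-- The interaction is of finite range: `Φ(X) = 0` when the diameter of `X` exceeds a constant. -/
def IsFiniteRange [MetricSpace Γ] : Prop :=
  ∃ c : ℝ, 0 < c ∧ ∀ X : Finset Γ, c < Metric.diam (X : Set Γ) → Φ.toFun X = 0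

/-- The local Hamiltonian `H_Λ = ∑_{X ⊆ Λ} Φ(X)`. -/
def hamiltonian (Λ : Finset Γ) : QuasiLocal d Γ := ∑ X ∈ Λ.powerset, Φ.toFun X

/-- The bounded derivation `δ_Λ(A) = i[H_Λ, A]` of `𝔄`. -/
def localDerivation (Λ : Finset Γ) : QuasiLocal d Γ →L[ℂ] QuasiLocal d Γ :=
  Complex.I • (ContinuousLinearMap.mul ℂ (QuasiLocal d Γ) (Φ.hamiltonian Λ) -
    (ContinuousLinearMap.mul ℂ (QuasiLocal d Γ)).flip (Φ.hamiltonian Λ))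

/-- The finite-volume dynamics `α_t^Λ = exp(t δ_Λ)`. -/
def localDynamics (Λ : Finset Γ) (t : ℝ) : QuasiLocal d Γ →L[ℂ] QuasiLocal d Γ :=
  NormedSpace.exp ((t : ℂ) • Φ.localDerivation Λ)

end Interaction

/-- The condition on the metric of the set of sites: distinct sites have distance at least `1`,
and for each radius the number of sites in a ball of that radius is bounded uniformly in its
centre. -/
structure IsUniformlyDiscrete (Γ : Type*) [MetricSpace Γ] : Prop where
  one_le_dist : ∀ x y : Γ, x ≠ y → 1 ≤ dist x y
  ball_card_le : ∀ M : ℝ, 0 < M → ∃ N : ℕ, ∀ x : Γ, (Metric.closedBall x M).encard ≤ N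

end SpinSystem

end

/-!
The dynamics `α_t` is the limit of the finite-volume dynamics `α_t^Λ = exp(tδ_Λ)`. The limit is
found for small times and strictly local observables from the exponential series, and then extended
to all times and observables by the group law and isometry.

* Observables of disjoint sets of sites commute (`commute_of_disjoint`), so only the sets `X` which
  meet `S` contribute to `δ_Λ(A) = ∑_{X ⊆ Λ} i[Φ(X), A]` for `A ∈ 𝔄(S)`. As the interaction has
  finite range, all of these `X` lie in a finite neighbourhood of `S`. Hence `δ_Λ(A)` is independent
  of `Λ` for large `Λ` and is strictly local, and the same holds for `δ_Λⁿ(A)`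
  (`exists_derivation`, `eventually_localDerivation_pow_eq`).
* Let `N` bound the number of sites of the sets with `Φ(X) ≠ 0`. If `A` is supported in at most `mN`
  sites, each commutator `i[Φ(X), A]` is supported in at most `(m+1)N` sites, and the sum of their
  norms is at most `2‖Φ‖mN‖A‖`. By induction
  `‖δ_Λⁿ(A)‖ ≤ (2‖Φ‖N)ⁿ m(m+1)⋯(m+n-1) ‖A‖` for all `Λ` (`norm_localDerivation_pow_le`). After
  division by `n!` the product becomes a binomial coefficient of polynomial growth in `n`. The
  exponential series of `δ_Λ` at `A` is therefore dominated, uniformly in `Λ`, by a series whose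
  radius of convergence does not depend on `A` (`exists_bound_expSeries`), and dominated convergence
  gives `α_t^Λ(A) → ∑ tⁿ/n! δⁿ(A)` for small `t`.
* Each `α_t^Λ` is the conjugation by the unitary `exp(itH_Λ)`, hence isometric. Convergence on the
  dense subalgebra `𝔄_loc` for small `t` thus gives convergence on `𝔄` for small `t`, and composing
  finitely many small times gives all `t` (`exists_limit_group`). Strong continuity at `t = 0` is
  continuity of the power series on `𝔄_loc`, and isometry and the group law do the rest
  (`continuous_orbit_of_dense`).
-/

namespace SpinSystem

/-! ### Locality -/

section Locality

variable {d : ℕ} {Γ : Type*} [DecidableEq Γ]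

/-- `A ⊗ I` and `I ⊗ B` commute. Both products have the matrix entries
`A (σ|S) (τ|S) * B (σ|X) (τ|X)`, because only one intermediate configuration contributes to the
matrix product. -/
theorem embed_commute {S X : Finset Γ} (hSX : Disjoint S X) (A : Obs d S) (B : Obs d X) :
    Commute (embed d (Finset.subset_union_left : S ≤ S ∪ X) A)
      (embed d (Finset.subset_union_right : X ≤ S ∪ X) B) := by
  have entry : ∀ {S X U : Finset Γ} (hS : S ≤ U) (hX : X ≤ U) (_ : Disjoint S X)
      (_ : U ≤ S ∪ X) (A : Obs d S) (B : Obs d X) (σ τ : U → Fin d),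
      (embedFun d hS A * embedFun d hX B) σ τ =
        A (restrictConfig d hS σ) (restrictConfig d hS τ) *
          B (restrictConfig d hX σ) (restrictConfig d hX τ) := by
    intro S X U hS hX hd hU A B σ τ
    have memX : ∀ x : U, x.1 ∉ S → x.1 ∈ X := fun x hx =>
      (Finset.mem_union.1 (hU x.2)).resolve_left hx
    have gX : restrictConfig d hX (glueConfig d σ (restrictConfig d hS τ)) =
        restrictConfig d hX σ := by
      funext x
      exact glue_off _ _ _ (Finset.disjoint_right.1 hd x.2)
    rw [Matrix.mul_apply,
      Finset.sum_eq_single (glueConfig d σ (restrictConfig d hS τ))]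
    · unfold embedFun
      rw [if_pos fun x hx => (glue_off _ _ _ hx).symm, if_pos, restrict_glue, gX]
      intro x hx
      have hxS : x.1 ∈ S := (Finset.mem_union.1 (hU x.2)).resolve_right hx
      simp [glueConfig, hxS, restrictConfig]
    · intro ρ _ hρ
      unfold embedFun
      split_ifs with h₁ h₂
      · refine absurd (funext fun x => ?_) hρ
        by_cases hx : x.1 ∈ S
        · rw [h₂ x (Finset.disjoint_left.1 hd hx)]
          simp [glueConfig, hx, restrictConfig]
        · rw [glue_off _ _ _ hx, h₁ x hx]
      all_goals simp
    · exact fun h => absurd (Finset.mem_univ _) h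
  ext σ τ
  change (embedFun d _ A * embedFun d _ B : Obs d (S ∪ X)) σ τ =
    (embedFun d _ B * embedFun d _ A : Obs d (S ∪ X)) σ τ
  rw [entry _ _ hSX le_rfl, entry _ _ hSX.symm (Finset.union_comm S X).le, mul_comm]

theorem toLimit_embed {S U : Finset Γ} (h : S ≤ U) (A : Obs d S) :
    toLimit d U (embed d h A) = toLimit d S A :=
  DirectLimit.Algebra.of_f (R := ℂ) (f := fun (_ _ : Finset Γ) h => embed d h) ..

variable [NeZero d]

theorem localAlgebra_mono {S U : Finset Γ} (h : S ≤ U) : localAlgebra d S ≤ localAlgebra d U := by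
  rintro _ ⟨A, rfl⟩
  exact ⟨embed d h A, congrArg ofLimit (toLimit_embed h A)⟩

theorem localAlgebra_le_strictlyLocal (S : Finset Γ) : localAlgebra d S ≤ strictlyLocal d Γ :=
  fun _ hA => mem_strictlyLocal.2 ⟨S, hA⟩

/-- Observables of disjoint sets of sites commute. -/
theorem commute_of_disjoint {S X : Finset Γ} (hSX : Disjoint S X) {A B : QuasiLocal d Γ}
    (hA : A ∈ localAlgebra d S) (hB : B ∈ localAlgebra d X) : Commute A B := by
  obtain ⟨A, rfl⟩ := hA
  obtain ⟨B, rfl⟩ := hB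
  have h := (embed_commute hSX A B).map ((ofLimitHom d Γ).comp (toLimit d (S ∪ X)))
  simpa [toLimit_embed] using h

theorem dense_strictlyLocal : Dense (strictlyLocal d Γ : Set (QuasiLocal d Γ)) :=
  UniformSpace.Completion.denseRange_coe (α := LocalLimit d Γ)

end Locality

namespace Interaction

variable {d : ℕ} {Γ : Type*} [DecidableEq Γ] [NeZero d] (Φ : Interaction d Γ)

theorem isSelfAdjoint_hamiltonian (Λ : Finset Γ) : IsSelfAdjoint (Φ.hamiltonian Λ) := by
  simp only [IsSelfAdjoint, hamiltonian, star_sum, (Φ.isSelfAdjoint _).star_eq]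

/-! ### The finite-volume derivations -/

theorem localDerivation_apply (Λ : Finset Γ) (A : QuasiLocal d Γ) :
    Φ.localDerivation Λ A = Complex.I • (Φ.hamiltonian Λ * A - A * Φ.hamiltonian Λ) := rfl

theorem localDerivation_star (Λ : Finset Γ) (A : QuasiLocal d Γ) :
    Φ.localDerivation Λ (star A) = star (Φ.localDerivation Λ A) := by
  simp only [localDerivation_apply, star_smul, star_sub, star_mul,
    (Φ.isSelfAdjoint_hamiltonian Λ).star_eq]
  rw [RCLike.star_def, Complex.conj_I, neg_smul, ← smul_neg, neg_sub]

theorem localDerivation_mul (Λ : Finset Γ) (A B : QuasiLocal d Γ) :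
    Φ.localDerivation Λ (A * B) = Φ.localDerivation Λ A * B + A * Φ.localDerivation Λ B := by
  simp only [localDerivation_apply, smul_mul_assoc, mul_smul_comm, ← smul_add]
  congr 1
  noncomm_ring

/-- The contribution `i[Φ(X), A]` of the set `X` to the derivations. -/
noncomputable def termCommutator (X : Finset Γ) (A : QuasiLocal d Γ) : QuasiLocal d Γ :=
  Complex.I • (Φ.toFun X * A - A * Φ.toFun X)

theorem norm_termCommutator_le (X : Finset Γ) (A : QuasiLocal d Γ) :
    ‖Φ.termCommutator X A‖ ≤ 2 * ‖Φ.toFun X‖ * ‖A‖ := by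
  rw [termCommutator, norm_smul, Complex.norm_I, one_mul]
  refine (norm_sub_le _ _).trans ?_
  have h₁ := norm_mul_le (Φ.toFun X) A
  have h₂ := norm_mul_le A (Φ.toFun X)
  linarith

theorem termCommutator_mem {S X : Finset Γ} {A : QuasiLocal d Γ} (hA : A ∈ localAlgebra d S) :
    Φ.termCommutator X A ∈ localAlgebra d (S ∪ X) := by
  have h₁ := localAlgebra_mono (Finset.subset_union_left (s₂ := X)) hA
  have h₂ := localAlgebra_mono (Finset.subset_union_right (s₁ := S)) (Φ.mem_localAlgebra X)
  exact SMulMemClass.smul_mem _ (sub_mem (mul_mem h₂ h₁) (mul_mem h₁ h₂))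

theorem termCommutator_eq_zero {S X : Finset Γ} {A : QuasiLocal d Γ} (hA : A ∈ localAlgebra d S)
    (hX : Disjoint S X) : Φ.termCommutator X A = 0 := by
  rw [termCommutator, (commute_of_disjoint hX hA (Φ.mem_localAlgebra X)).eq, sub_self, smul_zero]

theorem localDerivation_eq_sum (Λ : Finset Γ) (A : QuasiLocal d Γ) :
    Φ.localDerivation Λ A = ∑ X ∈ Λ.powerset, Φ.termCommutator X A := by
  simp only [localDerivation_apply, hamiltonian, termCommutator, Finset.sum_mul, Finset.mul_sum,
    ← Finset.sum_sub_distrib, Finset.smul_sum]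

/-- Only the sets which meet the support of `A` contribute to `δ_Λ(A)`. -/
theorem localDerivation_eq_sum_filter (Λ : Finset Γ) {S : Finset Γ} {A : QuasiLocal d Γ}
    (hA : A ∈ localAlgebra d S) :
    Φ.localDerivation Λ A =
      ∑ X ∈ Λ.powerset with ¬ Disjoint S X, Φ.termCommutator X A := by
  rw [localDerivation_eq_sum, Finset.sum_filter_of_ne]
  exact fun X _ h hX => h (Φ.termCommutator_eq_zero hA hX)

theorem localDerivation_mem (Λ : Finset Γ) {S : Finset Γ} {A : QuasiLocal d Γ}
    (hA : A ∈ localAlgebra d S) : Φ.localDerivation Λ A ∈ localAlgebra d (S ∪ Λ) := by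
  rw [localDerivation_eq_sum]
  exact sum_mem fun X hX => localAlgebra_mono
    (Finset.union_subset_union_right (Finset.mem_powerset.1 hX)) (Φ.termCommutator_mem hA)

variable {Φ}

theorem sum_norm_mem_le (hb : Φ.IsBounded) (x : Γ) (F : Finset (Finset Γ)) :
    ∑ X ∈ F with x ∈ X, ‖Φ.toFun X‖ ≤ Φ.size.toReal := by
  refine (ENNReal.ofReal_le_iff_le_toReal hb.ne).1 ?_
  rw [ENNReal.ofReal_sum_of_nonneg fun _ _ => norm_nonneg _]
  simp only [ofReal_norm]
  rw [← Finset.sum_subtype_eq_sum_filter]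
  exact (ENNReal.sum_le_tsum _).trans
    (le_iSup (fun x : Γ => ∑' X : {X : Finset Γ // x ∈ X}, ‖Φ.toFun X.1‖ₑ) x)

/-- The sets which meet `S` have total interaction strength at most `|S| ‖Φ‖`. -/
theorem sum_norm_meet_le (hb : Φ.IsBounded) (S : Finset Γ) (F : Finset (Finset Γ)) :
    ∑ X ∈ F with ¬ Disjoint S X, ‖Φ.toFun X‖ ≤ S.card * Φ.size.toReal := by
  calc ∑ X ∈ F with ¬ Disjoint S X, ‖Φ.toFun X‖
      ≤ ∑ X ∈ F with ¬ Disjoint S X, ∑ x ∈ S, if x ∈ X then ‖Φ.toFun X‖ else 0 := by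
        refine Finset.sum_le_sum fun X hX => ?_
        obtain ⟨x, hxS, hxX⟩ := Finset.not_disjoint_iff.1 (Finset.mem_filter.1 hX).2
        have h := Finset.single_le_sum (f := fun x => if x ∈ X then ‖Φ.toFun X‖ else 0)
          (fun y _ => by split_ifs <;> positivity) hxS
        simpa [hxX] using h
    _ ≤ ∑ X ∈ F, ∑ x ∈ S, if x ∈ X then ‖Φ.toFun X‖ else 0 :=
        Finset.sum_le_sum_of_subset_of_nonneg (Finset.filter_subset _ _) fun X _ _ =>
          Finset.sum_nonneg fun y _ => by split_ifs <;> positivity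
    _ = ∑ x ∈ S, ∑ X ∈ F with x ∈ X, ‖Φ.toFun X‖ := by
        rw [Finset.sum_comm]
        simp only [Finset.sum_filter]
    _ ≤ ∑ x ∈ S, Φ.size.toReal := Finset.sum_le_sum fun x _ => sum_norm_mem_le hb x F
    _ = S.card * Φ.size.toReal := by rw [Finset.sum_const, nsmul_eq_mul]

/-- The bound `‖δ_Λⁿ(A)‖ ≤ (2‖Φ‖N)ⁿ m(m+1)⋯(m+n-1) ‖A‖`, uniform in `Λ`, for `A` supported in at
most `mN` sites, where `N` bounds the number of sites of the sets with `Φ(X) ≠ 0`. Each of the terms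
`i[Φ(X), A]` of `δ_Λ(A)` is supported in at most `(m+1)N` sites. -/
theorem norm_localDerivation_pow_le (hb : Φ.IsBounded) {N : ℕ}
    (hN : ∀ X, Φ.toFun X ≠ 0 → X.card ≤ N) (Λ : Finset Γ) (n : ℕ) :
    ∀ (m : ℕ) (S : Finset Γ) (A : QuasiLocal d Γ), A ∈ localAlgebra d S → S.card ≤ m * N →
      ‖(Φ.localDerivation Λ ^ n) A‖ ≤
        (2 * Φ.size.toReal * N) ^ n * m.ascFactorial n * ‖A‖ := by
  induction n with
  | zero => intro m S A _ _; simp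
  | succ n ih =>
    intro m S A hA hS
    have hterm : ∀ X, ‖(Φ.localDerivation Λ ^ n) (Φ.termCommutator X A)‖ ≤
        (2 * Φ.size.toReal * N) ^ n * (m + 1).ascFactorial n * (2 * ‖A‖) * ‖Φ.toFun X‖ := by
      intro X
      by_cases hX : Φ.toFun X = 0
      · simp [termCommutator, hX]
      have hcard : (S ∪ X).card ≤ (m + 1) * N := by
        have h₁ := Finset.card_union_le S X
        have h₂ := hN X hX
        linarith
      refine (ih (m + 1) (S ∪ X) _ (Φ.termCommutator_mem hA) hcard).trans ?_
      rw [mul_assoc _ (2 * ‖A‖)]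
      refine mul_le_mul_of_nonneg_left ?_ (by positivity)
      linarith [Φ.norm_termCommutator_le X A]
    have hasc : (m.ascFactorial (n + 1) : ℝ) = m * (m + 1).ascFactorial n := by
      rw [Nat.ascFactorial_succ, ← Nat.succ_ascFactorial]
      push_cast
      rfl
    rw [pow_succ, mul_apply_eq_comp, localDerivation_eq_sum_filter Φ Λ hA, map_sum]
    calc _ ≤ ∑ X ∈ Λ.powerset with ¬ Disjoint S X,
          (2 * Φ.size.toReal * N) ^ n * (m + 1).ascFactorial n * (2 * ‖A‖) * ‖Φ.toFun X‖ :=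
          norm_sum_le_of_le _ fun X _ => hterm X
      _ ≤ (2 * Φ.size.toReal * N) ^ n * (m + 1).ascFactorial n * (2 * ‖A‖) *
          (m * N * Φ.size.toReal) := by
          rw [← Finset.mul_sum]
          refine mul_le_mul_of_nonneg_left ((sum_norm_meet_le hb S _).trans ?_) (by positivity)
          exact mul_le_mul_of_nonneg_right (by exact_mod_cast hS) ENNReal.toReal_nonneg
      _ = _ := by rw [hasc]; ring

/-! ### The limit derivation -/

section Metric

variable [MetricSpace Γ]

/-- A set of sites containing `x` on which a finite range interaction does not vanish lies in a
ball about `x`. -/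
theorem exists_forall_subset_closedBall (hr : Φ.IsFiniteRange) :
    ∃ c : ℝ, 0 < c ∧ ∀ X, Φ.toFun X ≠ 0 → ∀ x ∈ X, (X : Set Γ) ⊆ Metric.closedBall x c := by
  obtain ⟨c, hc, h⟩ := hr
  refine ⟨c, hc, fun X hX x hx y hy => ?_⟩
  have hd : Metric.diam (X : Set Γ) ≤ c := not_lt.1 fun h' => hX (h X h')
  exact (Metric.dist_le_diam_of_mem X.finite_toSet.isBounded hy hx).trans hd

theorem exists_card_le (hΓ : IsUniformlyDiscrete Γ) (hr : Φ.IsFiniteRange) :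
    ∃ N : ℕ, ∀ X, Φ.toFun X ≠ 0 → X.card ≤ N := by
  obtain ⟨c, hc, h⟩ := exists_forall_subset_closedBall hr
  obtain ⟨N, hN⟩ := hΓ.ball_card_le c hc
  refine ⟨N, fun X hX => ?_⟩
  obtain rfl | ⟨x, hx⟩ := X.eq_empty_or_nonempty
  · simp
  · have := (Set.encard_le_encard (h X hX x hx)).trans (hN x)
    rwa [Set.encard_coe_eq_coe_finsetCard, Nat.cast_le] at this

/-- On `𝔄(S)` the derivations `δ_Λ` agree for all `Λ` which contain the sites within the range of
the interaction of `S`. -/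
theorem exists_localDerivation_eq (hΓ : IsUniformlyDiscrete Γ) (hr : Φ.IsFiniteRange)
    (S : Finset Γ) : ∃ T : Finset Γ, ∀ Λ, T ≤ Λ → ∀ A ∈ localAlgebra d S,
      Φ.localDerivation Λ A = Φ.localDerivation T A := by
  obtain ⟨c, hc, h⟩ := exists_forall_subset_closedBall hr
  obtain ⟨N, hN⟩ := hΓ.ball_card_le c hc
  have hfin : (⋃ x ∈ S, Metric.closedBall x c).Finite :=
    S.finite_toSet.biUnion fun x _ => (Set.encard_le_coe_iff_finite_ncard_le.1 (hN x)).1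
  refine ⟨hfin.toFinset, fun Λ hΛ A hA => ?_⟩
  rw [localDerivation_eq_sum, localDerivation_eq_sum]
  refine (Finset.sum_subset (Finset.powerset_mono.2 hΛ) fun X _ hX => ?_).symm
  by_cases hX₀ : Φ.toFun X = 0
  · simp [termCommutator, hX₀]
  refine Φ.termCommutator_eq_zero hA (Finset.disjoint_left.2 fun x hxS hxX => hX ?_)
  rw [Finset.mem_powerset]
  intro y hy
  rw [Set.Finite.mem_toFinset]
  exact Set.mem_biUnion hxS (h X hX₀ x hxX hy)

/-- The derivation `δ` of `𝔄_loc` with which `δ_Λ` agrees on every strictly local observable, for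
all large `Λ`. -/
theorem exists_derivation (hΓ : IsUniformlyDiscrete Γ) (hr : Φ.IsFiniteRange) :
    ∃ δ : strictlyLocal d Γ →ₗ[ℂ] strictlyLocal d Γ, ∀ A : strictlyLocal d Γ,
      ∀ᶠ Λ in atTop, Φ.localDerivation Λ (A : QuasiLocal d Γ) = δ A := by
  have key : ∀ A : strictlyLocal d Γ, ∃ B : strictlyLocal d Γ,
      ∀ᶠ Λ in atTop, Φ.localDerivation Λ (A : QuasiLocal d Γ) = B := by
    intro A
    obtain ⟨S, hA⟩ := mem_strictlyLocal.1 A.2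
    obtain ⟨T, hT⟩ := exists_localDerivation_eq hΓ hr S
    exact ⟨⟨_, localAlgebra_le_strictlyLocal _ (Φ.localDerivation_mem T hA)⟩,
      eventually_atTop.2 ⟨T, fun Λ hΛ => hT Λ hΛ _ hA⟩⟩
  choose D hD using key
  refine ⟨{ toFun := D, map_add' := fun A B => ?_, map_smul' := fun r A => ?_ }, hD⟩
  · obtain ⟨Λ, h₁, h₂, h₃⟩ := (hD (A + B)).and ((hD A).and (hD B)) |>.exists
    apply Subtype.ext
    rw [← h₁]
    simp [h₂, h₃]
  · obtain ⟨Λ, h₁, h₂⟩ := (hD (r • A)).and (hD A) |>.exists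
    apply Subtype.ext
    rw [← h₁]
    simp [h₂]

end Metric

theorem eventually_localDerivation_pow_eq {δ : strictlyLocal d Γ →ₗ[ℂ] strictlyLocal d Γ}
    (hδ : ∀ A : strictlyLocal d Γ,
      ∀ᶠ Λ in atTop, Φ.localDerivation Λ (A : QuasiLocal d Γ) = δ A)
    (n : ℕ) (A : strictlyLocal d Γ) :
    ∀ᶠ Λ in atTop, (Φ.localDerivation Λ ^ n) (A : QuasiLocal d Γ) = (δ ^ n) A := by
  induction n generalizing A with
  | zero => simp
  | succ n ih =>
    filter_upwards [hδ A, ih (δ A)] with Λ h₁ h₂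
    rw [pow_succ, mul_apply_eq_comp, h₁, h₂, pow_succ, Module.End.mul_apply]

end Interaction

/-! ### Exponentials of bounded operators -/

section Exp

variable {E : Type*} [NormedAddCommGroup E] [NormedSpace ℂ E]

theorem exp_zero_smul_apply (T : E →L[ℂ] E) (x : E) :
    NormedSpace.exp (((0 : ℝ) : ℂ) • T) x = x := by
  rw [Complex.ofReal_zero, zero_smul, NormedSpace.exp_zero]
  rfl

variable [CompleteSpace E]

theorem hasSum_exp_apply (T : E →L[ℂ] E) (t : ℝ) (x : E) :
    HasSum (fun n : ℕ => ((t : ℂ) ^ n / (n.factorial : ℂ)) • (T ^ n) x)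
      (NormedSpace.exp ((t : ℂ) • T) x) := by
  have h := (NormedSpace.exp_series_hasSum_exp' (𝕂 := ℂ) ((t : ℂ) • T)).mapL
    (ContinuousLinearMap.apply ℂ E x)
  refine h.congr_fun fun n => ?_
  rw [smul_pow, smul_smul, div_eq_inv_mul]
  rfl

theorem exp_add_smul_apply (T : E →L[ℂ] E) (s t : ℝ) (x : E) :
    NormedSpace.exp (((s + t : ℝ) : ℂ) • T) x =
      NormedSpace.exp ((s : ℂ) • T) (NormedSpace.exp ((t : ℂ) • T) x) := by
  let : NormedAlgebra ℚ (E →L[ℂ] E) := .restrictScalars ℚ ℂ _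
  have hc : Commute ((s : ℂ) • T) ((t : ℂ) • T) := ((Commute.refl _).smul_left _).smul_right _
  rw [← mul_apply_eq_comp, ← NormedSpace.exp_add_of_commute hc, Complex.ofReal_add, add_smul]

variable {𝔅 : Type*} [NormedRing 𝔅] [NormedAlgebra ℂ 𝔅] [CompleteSpace 𝔅]

theorem exp_mulLeft_apply (a x : 𝔅) :
    NormedSpace.exp (ContinuousLinearMap.mul ℂ 𝔅 a) x = NormedSpace.exp a * x := by
  have hpow : ∀ n : ℕ, (ContinuousLinearMap.mul ℂ 𝔅 a ^ n) x = a ^ n * x := by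
    intro n
    induction n with
    | zero => simp
    | succ n ih => rw [pow_succ', mul_apply_eq_comp, ih, pow_succ']; simp [mul_assoc]
  have h := hasSum_exp_apply (ContinuousLinearMap.mul ℂ 𝔅 a) 1 x
  rw [Complex.ofReal_one, one_smul] at h
  refine h.unique (((NormedSpace.exp_series_hasSum_exp' (𝕂 := ℂ) a).mul_right x).congr_fun ?_)
  intro n
  simp [hpow]

theorem exp_mulRight_apply (a x : 𝔅) :
    NormedSpace.exp ((ContinuousLinearMap.mul ℂ 𝔅).flip a) x = x * NormedSpace.exp a := by
  have hpow : ∀ n : ℕ, ((ContinuousLinearMap.mul ℂ 𝔅).flip a ^ n) x = x * a ^ n := by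
    intro n
    induction n with
    | zero => simp
    | succ n ih => rw [pow_succ', mul_apply_eq_comp, ih, pow_succ]; simp [mul_assoc]
  have h := hasSum_exp_apply ((ContinuousLinearMap.mul ℂ 𝔅).flip a) 1 x
  rw [Complex.ofReal_one, one_smul] at h
  refine h.unique (((NormedSpace.exp_series_hasSum_exp' (𝕂 := ℂ) a).mul_left x).congr_fun ?_)
  intro n
  simp [hpow]

end Exp

/-! ### Limits of groups of automorphisms -/

section LimitGroup

variable {𝔅 : Type*} [CStarAlgebra 𝔅]

theorem dist_starAlgEquiv (e : 𝔅 ≃⋆ₐ[ℂ] 𝔅) (x y : 𝔅) : dist (e x) (e y) = dist x y := by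
  rw [dist_eq_norm, dist_eq_norm, ← map_sub, NonUnitalStarAlgHom.norm_map e e.injective]

/-- For a net of automorphisms of a C⋆-algebra, convergence on a dense set implies convergence
everywhere, because automorphisms are isometric. -/
theorem exists_tendsto_of_dense {ι : Type*} {l : Filter ι} [l.NeBot]
    (e : ι → (𝔅 ≃⋆ₐ[ℂ] 𝔅)) {D : Set 𝔅} (hD : Dense D)
    (h : ∀ x ∈ D, ∃ y, Tendsto (fun i => e i x) l (𝓝 y)) (x : 𝔅) :
    ∃ y, Tendsto (fun i => e i x) l (𝓝 y) := by
  rw [← cauchy_map_iff_exists_tendsto, Metric.cauchy_iff]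
  refine ⟨inferInstance, fun ε hε => ?_⟩
  obtain ⟨z, hz, hxz⟩ := Metric.mem_closure_iff.1 (hD x) (ε / 4) (by positivity)
  obtain ⟨y, hy⟩ := h z hz
  refine ⟨_, image_mem_map (Metric.tendsto_nhds.1 hy (ε / 4) (by positivity)), ?_⟩
  have hclose : ∀ i, dist (e i z) y < ε / 4 → dist (e i x) y < ε / 2 := by
    intro i hi
    have h₁ := dist_triangle (e i x) (e i z) y
    rw [dist_starAlgEquiv] at h₁
    linarith
  rintro _ ⟨i, hi, rfl⟩ _ ⟨j, hj, rfl⟩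
  have h₁ := dist_triangle_right (e i x) (e j x) y
  linarith [hclose i hi, hclose j hj]

/-- A net of one-parameter groups of automorphisms which converges on a dense set for small times
converges for all times, and its limit is a one-parameter group of automorphisms. -/
theorem exists_limit_group {ι : Type*} {l : Filter ι} [l.NeBot]
    (e : ι → ℝ → (𝔅 ≃⋆ₐ[ℂ] 𝔅)) (e_zero : ∀ i x, e i 0 x = x)
    (e_add : ∀ i s t x, e i (s + t) x = e i s (e i t x)) {D : Set 𝔅} (hD : Dense D)
    {t₀ : ℝ} (ht₀ : 0 < t₀)
    (h : ∀ t, |t| < t₀ → ∀ x ∈ D, ∃ y, Tendsto (fun i => e i t x) l (𝓝 y)) :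
    ∃ α : ℝ → (𝔅 ≃⋆ₐ[ℂ] 𝔅), (∀ x, α 0 x = x) ∧ (∀ s t x, α (s + t) x = α s (α t x)) ∧
      ∀ t x, Tendsto (fun i => e i t x) l (𝓝 (α t x)) := by
  have comp : ∀ {s t x y z}, Tendsto (fun i => e i t x) l (𝓝 y) →
      Tendsto (fun i => e i s y) l (𝓝 z) → Tendsto (fun i => e i (s + t) x) l (𝓝 z) := by
    intro s t x y z hy hz
    rw [tendsto_iff_dist_tendsto_zero] at hy hz ⊢
    refine squeeze_zero (fun _ => dist_nonneg) (fun i => ?_) (by simpa using hy.add hz)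
    rw [e_add]
    refine (dist_triangle _ (e i s y) z).trans_eq ?_
    rw [dist_starAlgEquiv]
  have mult : ∀ (n : ℕ) (t : ℝ), |t| < t₀ → ∀ x, ∃ y,
      Tendsto (fun i => e i (n * t) x) l (𝓝 y) := by
    intro n t ht
    induction n with
    | zero => intro x; exact ⟨x, by simp [e_zero]⟩
    | succ n ih =>
      intro x
      obtain ⟨y, hy⟩ := exists_tendsto_of_dense (fun i => e i t) hD (h t ht) x
      obtain ⟨z, hz⟩ := ih y
      refine ⟨z, ?_⟩
      have : ((n + 1 : ℕ) : ℝ) * t = n * t + t := by push_cast; ring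
      rw [this]
      exact comp hy hz
  have all : ∀ t x, ∃ y, Tendsto (fun i => e i t x) l (𝓝 y) := by
    intro t x
    obtain ⟨n, hn⟩ := exists_nat_gt (|t| / t₀)
    have hn₀ : (0 : ℝ) < n := (div_nonneg (abs_nonneg t) ht₀.le).trans_lt hn
    have := mult n (t / n) (by rwa [abs_div, Nat.abs_cast, div_lt_comm₀ hn₀ ht₀]) x
    rwa [mul_div_cancel₀ t hn₀.ne'] at this
  choose a ha using all
  have a_zero : ∀ x, a 0 x = x := fun x =>
    tendsto_nhds_unique (ha 0 x) (by simp [e_zero])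
  have a_add : ∀ s t x, a (s + t) x = a s (a t x) := fun s t x =>
    tendsto_nhds_unique (ha (s + t) x) (comp (ha t x) (ha s (a t x)))
  refine ⟨fun t =>
    { toFun := a t
      invFun := a (-t)
      left_inv := fun x => by rw [← a_add, neg_add_cancel, a_zero]
      right_inv := fun x => by rw [← a_add, add_neg_cancel, a_zero]
      map_mul' := fun x y => tendsto_nhds_unique (ha t (x * y))
        (by simpa using (ha t x).mul (ha t y))
      map_add' := fun x y => tendsto_nhds_unique (ha t (x + y))
        (by simpa using (ha t x).add (ha t y))
      map_star' := fun x => tendsto_nhds_unique (ha t (star x))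
        (by simpa [map_star] using (ha t x).star)
      map_smul' := fun r x => tendsto_nhds_unique (ha t (r • x))
        (by simpa using (ha t x).const_smul r) }, a_zero, a_add, ha⟩

/-- A one-parameter group of automorphisms is strongly continuous if its orbits through a dense set
are continuous at time `0`. -/
theorem continuous_orbit_of_dense {α : ℝ → (𝔅 ≃⋆ₐ[ℂ] 𝔅)}
    (h_zero : ∀ x, α 0 x = x) (h_add : ∀ s t x, α (s + t) x = α s (α t x)) {D : Set 𝔅}
    (hD : Dense D) (h : ∀ x ∈ D, ContinuousAt (fun t => α t x) 0) (x : 𝔅) :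
    Continuous fun t => α t x := by
  have at_zero : ∀ x, Tendsto (fun t => α t x) (𝓝 0) (𝓝 x) := by
    intro x
    rw [Metric.tendsto_nhds]
    intro ε hε
    obtain ⟨z, hz, hxz⟩ := Metric.mem_closure_iff.1 (hD x) (ε / 3) (by positivity)
    have hz₀ := h z hz
    rw [ContinuousAt, h_zero] at hz₀
    filter_upwards [Metric.tendsto_nhds.1 hz₀ (ε / 3) (by positivity)] with t ht
    have h₁ := dist_triangle4 (α t x) (α t z) z x
    rw [dist_starAlgEquiv, dist_comm z x] at h₁
    linarith
  refine continuous_iff_continuousAt.2 fun s => ?_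
  have h₁ : Tendsto (fun t : ℝ => t - s) (𝓝 s) (𝓝 0) := by
    simpa using (continuous_id.sub continuous_const).tendsto (f := fun t : ℝ => t - s) s
  refine ((at_zero (α s x)).comp h₁).congr fun t => ?_
  rw [Function.comp_apply, ← h_add, sub_add_cancel]

end LimitGroup

/-! ### The finite-volume dynamics -/

namespace Interaction

variable {d : ℕ} {Γ : Type*} [DecidableEq Γ] [NeZero d] (Φ : Interaction d Γ)

theorem localDynamics_eq_conj (Λ : Finset Γ) (t : ℝ) (A : QuasiLocal d Γ) :
    Φ.localDynamics Λ t A =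
      NormedSpace.exp ((Complex.I * t) • Φ.hamiltonian Λ) * A *
        NormedSpace.exp (-(Complex.I * t) • Φ.hamiltonian Λ) := by
  let : NormedAlgebra ℚ (QuasiLocal d Γ →L[ℂ] QuasiLocal d Γ) := .restrictScalars ℚ ℂ _
  set H := Φ.hamiltonian Λ
  have h : (t : ℂ) • Φ.localDerivation Λ =
      ContinuousLinearMap.mul ℂ _ ((Complex.I * t) • H) +
        (ContinuousLinearMap.mul ℂ _).flip (-(Complex.I * t) • H) := by
    ext A
    change (t : ℂ) • Complex.I • (H * A - A * H) =
      (Complex.I * t) • H * A + A * -(Complex.I * t) • H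
    rw [smul_smul, mul_comm (t : ℂ), smul_mul_assoc, mul_smul_comm, neg_smul, smul_sub,
      sub_eq_add_neg]
  have hc : Commute (ContinuousLinearMap.mul ℂ _ ((Complex.I * t) • H))
      ((ContinuousLinearMap.mul ℂ _).flip (-(Complex.I * t) • H)) := by
    ext A
    simp only [mul_apply_eq_comp, ContinuousLinearMap.mul_apply', ContinuousLinearMap.flip_apply,
      mul_assoc]
  rw [localDynamics, h, NormedSpace.exp_add_of_commute hc, mul_apply_eq_comp, exp_mulRight_apply,
    exp_mulLeft_apply, mul_assoc]

theorem localDynamics_zero (Λ : Finset Γ) (A : QuasiLocal d Γ) : Φ.localDynamics Λ 0 A = A :=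
  exp_zero_smul_apply _ _

theorem localDynamics_add (Λ : Finset Γ) (s t : ℝ) (A : QuasiLocal d Γ) :
    Φ.localDynamics Λ (s + t) A = Φ.localDynamics Λ s (Φ.localDynamics Λ t A) :=
  exp_add_smul_apply _ _ _ _

/-- `α_t^Λ` is a `*`-automorphism, being the conjugation by the unitary `exp(itH_Λ)`. -/
theorem exists_localAutomorphism (Λ : Finset Γ) (t : ℝ) :
    ∃ e : QuasiLocal d Γ ≃⋆ₐ[ℂ] QuasiLocal d Γ, ∀ A, e A = Φ.localDynamics Λ t A := by
  have hH : IsSelfAdjoint ((t : ℂ) • Φ.hamiltonian Λ) :=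
    .smul (by simp [isSelfAdjoint_iff]) (Φ.isSelfAdjoint_hamiltonian Λ)
  refine ⟨Unitary.conjStarAlgAut ℂ _ (selfAdjoint.expUnitary ⟨_, hH⟩), fun A => ?_⟩
  have hstar : star ((Complex.I * t) • Φ.hamiltonian Λ) =
      -(Complex.I * t) • Φ.hamiltonian Λ := by
    rw [star_smul, (Φ.isSelfAdjoint_hamiltonian Λ).star_eq]
    simp
  rw [localDynamics_eq_conj, Unitary.conjStarAlgAut_apply, ← hstar, ← NormedSpace.star_exp]
  simp only [selfAdjoint.expUnitary_coe, smul_smul]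

variable {Φ}

/-- A common summable bound for the exponential series of all the `δ_Λ` at a strictly local
observable. Its radius of validity does not depend on the observable. -/
theorem exists_bound_expSeries [MetricSpace Γ] (hΓ : IsUniformlyDiscrete Γ) (hb : Φ.IsBounded)
    (hr : Φ.IsFiniteRange) :
    ∃ t₀ : ℝ, 0 < t₀ ∧ ∀ (A : strictlyLocal d Γ) (r : ℝ), 0 ≤ r → r < t₀ →
      ∃ u : ℕ → ℝ, Summable u ∧ ∀ (Λ : Finset Γ) (n : ℕ) (t : ℝ), |t| ≤ r →
        ‖((t : ℂ) ^ n / (n.factorial : ℂ)) •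
          (Φ.localDerivation Λ ^ n) (A : QuasiLocal d Γ)‖ ≤ u n := by
  obtain ⟨N, hN⟩ := exists_card_le hΓ hr
  -- `N + 1` ensures `|S| ≤ (|S| + 1) (N + 1)`, and the summand `1` allows the inversion of `K`
  set K : ℝ := 2 * Φ.size.toReal * (N + 1 : ℕ) + 1
  have hK : 0 < K := by positivity
  refine ⟨K⁻¹, inv_pos.2 hK, fun A r hr₀ hrt => ?_⟩
  obtain ⟨S, hA⟩ := mem_strictlyLocal.1 A.2
  have hrK : ‖r * K‖ < 1 := by
    rw [Real.norm_of_nonneg (by positivity)]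
    rwa [← one_div, lt_div_iff₀ hK] at hrt
  refine ⟨fun n => ((n + S.card).choose S.card : ℝ) * (r * K) ^ n * ‖(A : QuasiLocal d Γ)‖,
    (summable_choose_mul_geometric_of_norm_lt_one _ hrK).mul_right _, fun Λ n t ht => ?_⟩
  have hbound := norm_localDerivation_pow_le hb (N := N + 1) (fun X hX => (hN X hX).trans (by simp))
    Λ n (S.card + 1) S A hA (by nlinarith)
  have hfac : ((S.card + 1).ascFactorial n : ℝ) = n.factorial * (n + S.card).choose S.card := by
    rw [Nat.ascFactorial_eq_factorial_mul_choose, add_comm n, ← Nat.choose_symm_add]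
    push_cast
    rfl
  have hpow : (2 * Φ.size.toReal * (N + 1 : ℕ)) ^ n ≤ K ^ n :=
    pow_le_pow_left₀ (by positivity) (by simp [K]) n
  have hn : (0 : ℝ) < n.factorial := by positivity
  rw [norm_smul, norm_div, norm_pow, Complex.norm_real, Complex.norm_natCast, Real.norm_eq_abs]
  calc |t| ^ n / n.factorial * ‖(Φ.localDerivation Λ ^ n) (A : QuasiLocal d Γ)‖
      ≤ r ^ n / n.factorial *
        (K ^ n * (n.factorial * (n + S.card).choose S.card) * ‖(A : QuasiLocal d Γ)‖) := by
        rw [hfac] at hbound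
        refine mul_le_mul (by gcongr) (hbound.trans ?_) (norm_nonneg _) (by positivity)
        gcongr
    _ = _ := by simp only [mul_pow]; field_simp

end Interaction

end SpinSystem

/-! ### The infinite-volume dynamics -/

open SpinSystem Interaction in
theorem mainTheorem2 {d : ℕ} [NeZero d] {Γ : Type*} [DecidableEq Γ] [MetricSpace Γ]
    (hΓ : SpinSystem.IsUniformlyDiscrete Γ) (Φ : SpinSystem.Interaction d Γ)
    (hb : Φ.IsBounded) (hr : Φ.IsFiniteRange) :
    -- the symmetric derivation `δ(A) = lim_Λ i[H_Λ, A]`, which maps `𝔄_loc` into itself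
    ∃ δ : SpinSystem.strictlyLocal d Γ →ₗ[ℂ] SpinSystem.strictlyLocal d Γ,
      (∀ A : SpinSystem.strictlyLocal d Γ,
        Tendsto (fun Λ : Finset Γ => Φ.localDerivation Λ (A : SpinSystem.QuasiLocal d Γ)) atTop
          (𝓝 (δ A : SpinSystem.QuasiLocal d Γ))) ∧
      (∀ A, δ (star A) = star (δ A)) ∧
      (∀ A B, δ (A * B) = δ A * B + A * δ B) ∧
      -- the group of automorphisms
      ∃ α : ℝ → (SpinSystem.QuasiLocal d Γ ≃⋆ₐ[ℂ] SpinSystem.QuasiLocal d Γ),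
        (∀ A, α 0 A = A) ∧
        (∀ s t A, α (s + t) A = α s (α t A)) ∧
        (∀ A, Continuous fun t => α t A) ∧
        -- it extends `exp(tδ)`, which converges on `𝔄_loc` for small `t`
        (∃ t₀ : ℝ, 0 < t₀ ∧ ∀ (A : SpinSystem.strictlyLocal d Γ) (t : ℝ), |t| < t₀ →
          HasSum (fun n : ℕ => ((t : ℂ) ^ n / (n.factorial : ℂ)) •
            (((δ ^ n) A : SpinSystem.strictlyLocal d Γ) : SpinSystem.QuasiLocal d Γ))
            (α t A)) ∧
        -- convergence of the finite-volume dynamics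
        (∀ (A : SpinSystem.QuasiLocal d Γ) (t : ℝ),
          Tendsto (fun Λ : Finset Γ => ‖Φ.localDynamics Λ t A - α t A‖) atTop (𝓝 0)) ∧
        (∀ (Λ : Finset Γ) (t : ℝ) (A : SpinSystem.QuasiLocal d Γ),
          Φ.localDynamics Λ t A =
            NormedSpace.exp ((Complex.I * t) • Φ.hamiltonian Λ) * A *
              NormedSpace.exp (-(Complex.I * t) • Φ.hamiltonian Λ)) := by
  obtain ⟨δ, hδ⟩ := exists_derivation hΓ hr
  obtain ⟨t₀, ht₀, hbound⟩ := exists_bound_expSeries hΓ hb hr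
  have hpow := eventually_localDerivation_pow_eq hδ
  -- the bound on the terms of the series passes to the limit `Λ → ∞`
  have hbound_lim : ∀ (A : strictlyLocal d Γ) (r : ℝ), 0 ≤ r → r < t₀ →
      ∃ u : ℕ → ℝ, Summable u ∧ ∀ (n : ℕ) (t : ℝ), |t| ≤ r →
        ‖((t : ℂ) ^ n / (n.factorial : ℂ)) • ((δ ^ n) A : QuasiLocal d Γ)‖ ≤ u n := by
    intro A r hr₀ hrt
    obtain ⟨u, hu, h⟩ := hbound A r hr₀ hrt
    refine ⟨u, hu, fun n t ht => ?_⟩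
    obtain ⟨Λ, hΛ⟩ := (hpow n A).exists
    rw [← hΛ]
    exact h Λ n t ht
  have hlim : ∀ t, |t| < t₀ → ∀ A : strictlyLocal d Γ,
      Tendsto (fun Λ => Φ.localDynamics Λ t (A : QuasiLocal d Γ)) atTop
        (𝓝 (∑' n : ℕ, ((t : ℂ) ^ n / (n.factorial : ℂ)) • ((δ ^ n) A : QuasiLocal d Γ))) := by
    intro t ht A
    obtain ⟨u, hu, h⟩ := hbound A |t| (abs_nonneg t) ht
    simp only [localDynamics, ← (hasSum_exp_apply _ t _).tsum_eq]
    refine tendsto_tsum_of_dominated_convergence hu (fun n => ?_)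
      (Eventually.of_forall fun Λ n => h Λ n t le_rfl)
    exact tendsto_nhds_of_eventually_eq ((hpow n A).mono fun Λ hΛ => by rw [hΛ])
  choose e he using Φ.exists_localAutomorphism
  obtain ⟨α, α_zero, α_add, hα⟩ := exists_limit_group (l := atTop) e
    (fun Λ A => by rw [he, localDynamics_zero])
    (fun Λ s t A => by rw [he, he, he, localDynamics_add]) dense_strictlyLocal ht₀
    (fun t ht A hA => ⟨_, by simpa only [he] using hlim t ht ⟨A, hA⟩⟩)
  simp only [he] at hα
  have hα_tsum : ∀ (A : strictlyLocal d Γ) (t : ℝ), |t| < t₀ → α t A =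
      ∑' n : ℕ, ((t : ℂ) ^ n / (n.factorial : ℂ)) • ((δ ^ n) A : QuasiLocal d Γ) :=
    fun A t ht => tendsto_nhds_unique (hα t A) (hlim t ht A)
  refine ⟨δ, fun A => tendsto_nhds_of_eventually_eq (hδ A), fun A => ?_, fun A B => ?_, α, α_zero,
    α_add, continuous_orbit_of_dense α_zero α_add dense_strictlyLocal fun A hA => ?_,
    ⟨t₀, ht₀, fun A t ht => ?_⟩, fun A t => ?_, Φ.localDynamics_eq_conj⟩
  · obtain ⟨Λ, h₁, h₂⟩ := (hδ (star A)).and (hδ A) |>.exists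
    apply Subtype.ext
    rw [← h₁, StarMemClass.coe_star, StarMemClass.coe_star, localDerivation_star, h₂]
  · obtain ⟨Λ, h₁, h₂, h₃⟩ := (hδ (A * B)).and ((hδ A).and (hδ B)) |>.exists
    apply Subtype.ext
    rw [← h₁, MulMemClass.coe_mul, localDerivation_mul, h₂, h₃]
    rfl
  · -- on `|t| ≤ t₀ / 2` the orbit is a uniformly convergent power series in `t`
    obtain ⟨u, hu, h⟩ := hbound_lim ⟨A, hA⟩ (t₀ / 2) (by positivity) (by linarith)
    have hcont : ContinuousOn (fun t : ℝ => ∑' n : ℕ, ((t : ℂ) ^ n / (n.factorial : ℂ)) •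
        ((δ ^ n) ⟨A, hA⟩ : QuasiLocal d Γ)) (Metric.closedBall 0 (t₀ / 2)) :=
      continuousOn_tsum (fun n => by fun_prop) hu fun n t ht => h n t (by simpa using ht)
    have hnhds := Metric.closedBall_mem_nhds (0 : ℝ) (ε := t₀ / 2) (by positivity)
    refine (hcont.continuousAt hnhds).congr ?_
    filter_upwards [hnhds] with t ht
    have ht' : |t| ≤ t₀ / 2 := by simpa using ht
    exact (hα_tsum ⟨A, hA⟩ t (by linarith)).symm
  · obtain ⟨u, hu, h⟩ := hbound_lim A |t| (abs_nonneg t) ht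
    rw [hα_tsum A t ht]
    exact (hu.of_norm_bounded fun n => h n t le_rfl).hasSum
  · simpa only [dist_eq_norm] using tendsto_iff_dist_tendsto_zero.1 (hα t A)
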